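/- Conventions. Formulas are first order. Let $\lambda$ be an infinite cardinal. A (proper) filter $D$ on a set $I$ with $|I|=\lambda$ is \emph{$\lambda$-regular} if there are finite sets $u_s\subseteq\lambda$ $(s\in I)$ such that $\{s\in I:\alpha\in u_s\}\in D$ for every $\alpha<\lambda$. For a structure $M$, the reduced power $M^I/D$ consists of the functions $I\to M$ modulo equality on a set of $D$; functions are computed pointwise, and a relation holds in it iff it holds pointwise on a set of $D$. For a set $\Delta$ of formulas, a structure $N$ is \emph{$(\lambda^+,\Delta)$-saturated} if the following holds for every set $\Gamma$ of at most $\lambda$ formulas in finitely many variables $x_0,\dots,x_{m-1}$ altogether, each obtained from a formula of $\Delta$ by replacing every free variable by some $x_k$ or by a parameter from $N$: if every finite subset of $\Gamma$ is realized in $N$, then $\Gamma$ is realized in $N$. The order. For theories $T_1,T_2$ and sets $\Delta_1,\Delta_2$ of atomic formulas in their respective languages, $(T_1,\Delta_1)\trianglelefteq^{\mathrm{rp}}_\lambda(T_2,\Delta_2)$ means: for every $\lambda$-regular filter $D$ on a set $I$ of cardinality $\lambda$ and all models $M_1\models T_1$, $M_2\models T_2$, if $M_2^I/D$ is $(\lambda^+,\Delta_2)$-saturated,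 then $M_1^I/D$ is $(\lambda^+,\Delta_1)$-saturated. For arbitrary sets of formulas it means $(T_1^+,\Delta_1^+)\trianglelefteq^{\mathrm{rp}}_\lambda(T_2^+,\Delta_2^+)$, where $T_\ell^+$ is $T_\ell$ together with the axioms $\forall\bar x\,(\varphi(\bar x)\leftrightarrow P_\varphi(\bar x))$ for $\varphi\in\Delta_\ell$, with new predicates $P_\varphi$, and $\Delta_\ell^+=\{P_\varphi(\bar x):\varphi\in\Delta_\ell\}$. For theories, $T_1\trianglelefteq^{\mathrm{rp}}_\lambda T_2$ is the relation for $\Delta_\ell=$ the set of all atomic formulas of the language of $T_\ell$. A pair, or a theory, is \emph{$\trianglelefteq^{\mathrm{rp}}_\lambda$-maximal} if every pair, respectively every theory (in any language), is $\trianglelefteq^{\mathrm{rp}}_\lambda$ it. A pair $(T,\varphi(\bar x,\bar y))$ with $\mathrm{lg}(\bar x)=\mathrm{lg}(\bar y)$ has $\mathrm{SOP}_3$ if some model of $T$ contains tuples $\bar a_i$ $(i<\omega)$ with $\models\varphi(\bar a_i,\bar a_j)$ for all $i<j$, and no model of $T$ contains tuples $\bar a,\bar b,\bar c$ with $\models\varphi(\bar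 a,\bar b)\wedge\varphi(\bar b,\bar c)\wedge\varphi(\bar c,\bar a)$. Theorem. Let $T$ be a complete first order theory and let $\varphi(\bar x,\bar y)$ be a formula such that $(T,\varphi(\bar x,\bar y))$ has $\mathrm{SOP}_3$. Then for every infinite cardinal $\lambda$: (1) the pair $(T,\{\varphi\})$ is $\trianglelefteq^{\mathrm{rp}}_\lambda$-maximal; (2) more generally, every pair $(T,\Delta)$ with $\varphi\in\Delta$ is $\trianglelefteq^{\mathrm{rp}}_\lambda$-maximal (for example, if $\varphi$ is quantifier-free, with $\Delta$ the set of all quantifier-free formulas); (3) if $\varphi$ is atomic, then $(T_1,\Delta_1)\trianglelefteq^{\mathrm{rp}}_\lambda(T,\{\varphi\})$ for every theory $T_1$ and every set $\Delta_1$ of atomic formulas, with no new predicates $P_\varphi$ added; (4) if $\varphi$ is atomic, or more generally equivalent modulo $T$ to a finite conjunction of atomic formulas, then $T$ itself is $\trianglelefteq^{\mathrm{rp}}_\lambda$-maximal: whenever $D$ is a $\lambda$-regular filter on a set $I$ of cardinality $\lambda$ and $M^I/D$ is $\lambda^+$-saturated for atomic formulas for some model $M$ of $T$, then $N^I/D$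 is $\lambda^+$-saturated for atomic formulas for every structure $N$. -/

import Mathlib

universe t u v w u₁ v₁ w₁ u₂ v₂ w₂

namespace ReducedPowerOrder

open FirstOrder Filter Cardinal


/-! ### Reduced powers -/

section ReducedPower

variable {I : Type t} (D : Filter I) (M : Type w)

/-- The reduced power `M^I / D`: functions `I → M` modulo equality on a set of `D`. -/
def ReducedPower : Type (max t w) :=
  Quotient (D.productSetoid fun _ : I => M)

variable (L : FirstOrder.Language.{u, v}) [L.Structure M]

/-- The pointwise operations on `I → M`, and the relations "holds on a set of `D`"; they respect
equality modulo `D`. -/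
instance prestructure : L.Prestructure (D.productSetoid fun _ : I => M) :=
  { D.productSetoid fun _ : I => M with
    toStructure :=
      { funMap := fun {_} f x s => FirstOrder.Language.Structure.funMap f fun i => x i s
        RelMap := fun {_} r x => ∀ᶠ s in D, FirstOrder.Language.Structure.RelMap r fun i => x i s }
    fun_equiv := fun {n} f x y xy => by
      have h : ∀ᶠ s in D, ∀ i, x i s = y i s := eventually_all.2 xy
      exact h.mono fun s hs => congrArg (FirstOrder.Language.Structure.funMap f) (funext hs)
    rel_equiv := fun {n} r x y xy => by
      have h : ∀ᶠ s in D, ∀ i, x i s = y i s := eventually_all.2 xy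
      exact propext (eventually_congr (h.mono fun s hs => by rw [funext hs])) }

/-- The reduced power as an `L`-structure. -/
instance reducedPowerStructure : L.Structure (ReducedPower D M) :=
  inferInstanceAs <| L.Structure (Quotient (D.productSetoid fun _ : I => M))

end ReducedPower

/-- `D` is `lam`-regular: there is a set `J` of size `lam` and a finite `u s ⊆ J` for each index `s`
such that every `j ∈ J` lies in `u s` for `D`-almost all `s`. -/
def IsRegularFilter {I : Type t} (lam : Cardinal.{t}) (D : Filter I) : Prop :=
  ∃ J : Type t, #J = lam ∧ ∃ u : I → Finset J, ∀ j : J, ∀ᶠ s in D, j ∈ u s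

/-! ### Sets of formulas and saturation -/

/-- Sets of first order formulas, each one with finitely many listed free variables. -/
abbrev FormulaSet (L : FirstOrder.Language.{u, v}) : Type (max u v) :=
  Set (Σ n : ℕ, L.Formula (Fin n))

/-- The set of atomic formulas (equations between terms included). -/
def atomicFormulas (L : FirstOrder.Language.{u, v}) : FormulaSet L :=
  {p | p.2.IsAtomic}

/-- `N` is `(κ, Δ)`-saturated: let `Γ` be a set of fewer than `κ` formulas, in finitely many
variables `x_0, …, x_{m-1}` altogether, each of which arises from a formula of `Δ` by replacing every
free variable by some `x_k` or by a parameter from `N`. If every finite subset of `Γ` is satisfied by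
some tuple of `N`, then so is `Γ`. The set `Γ` is given as a family indexed by a type `J` of
cardinality less than `κ`. -/
def IsSaturatedFor (κ : Cardinal.{t}) {L : FirstOrder.Language.{u, v}} (Δ : FormulaSet L)
    (N : Type w) [L.Structure N] : Prop :=
  ∀ (m : ℕ) (J : Type t), #J < κ →
    ∀ (φ : J → Σ n : ℕ, L.Formula (Fin n)), (∀ j, φ j ∈ Δ) →
    ∀ (σ : ∀ j, Fin (φ j).1 → Fin m ⊕ N),
      (∀ F : Finset J, ∃ c : Fin m → N, ∀ j ∈ F,
        (φ j).2.Realize fun i => Sum.elim c id (σ j i)) →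
      ∃ c : Fin m → N, ∀ j, (φ j).2.Realize fun i => Sum.elim c id (σ j i)

/-! ### The order on pairs (theory, set of formulas) -/

/-- `(T₁, Δ₁) ⊴^rp_lam (T₂, Δ₂)` for sets `Δ₁`, `Δ₂` of atomic formulas: for every `lam`-regular
filter `D` on a set of size `lam` and all models `M₁ ⊨ T₁`, `M₂ ⊨ T₂`, if the reduced power of `M₂`
is `(lam⁺, Δ₂)`-saturated then the reduced power of `M₁` is `(lam⁺, Δ₁)`-saturated. -/
def RPLEAtomic (lam : Cardinal.{t}) {L₁ : FirstOrder.Language.{u₁, v₁}} (T₁ : L₁.Theory) (Δ₁ : FormulaSet L₁)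
    {L₂ : FirstOrder.Language.{u₂, v₂}} (T₂ : L₂.Theory) (Δ₂ : FormulaSet L₂) : Prop :=
  ∀ (I : Type t) (D : Filter I), #I = lam → D.NeBot → IsRegularFilter lam D →
    ∀ (M₁ : Type w₁) [L₁.Structure M₁] [Nonempty M₁] [M₁ ⊨ T₁]
      (M₂ : Type w₂) [L₂.Structure M₂] [Nonempty M₂] [M₂ ⊨ T₂],
      IsSaturatedFor (Order.succ lam) Δ₂ (ReducedPower D M₂) →
        IsSaturatedFor (Order.succ lam) Δ₁ (ReducedPower D M₁)

section Morley

variable {L : FirstOrder.Language.{u, v}} (T : L.Theory) (Δ : FormulaSet L)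

/-- One new `n`-ary predicate `P_φ` for each `φ(x_0, …, x_{n-1})` in `Δ`, no function symbols. -/
def newPredicates : FirstOrder.Language.{0, max u v} where
  Functions := fun _ => Empty
  Relations := fun n => {φ : L.Formula (Fin n) // (⟨n, φ⟩ : Σ n : ℕ, L.Formula (Fin n)) ∈ Δ}

/-- The language `L` together with the predicates `P_φ`, `φ ∈ Δ`. -/
abbrev morleyLanguage : FirstOrder.Language.{u, max u v} :=
  L.sum (newPredicates Δ)

variable {Δ} in
/-- The atomic formula `P_φ(x_0, …, x_{n-1})`. -/
def morleyAtom {n : ℕ} (φ : L.Formula (Fin n))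
    (hφ : (⟨n, φ⟩ : Σ n : ℕ, L.Formula (Fin n)) ∈ Δ) : (morleyLanguage Δ).Formula (Fin n) :=
  FirstOrder.Language.Relations.formula (L := morleyLanguage Δ)
    (Sum.inr (⟨φ, hφ⟩ : (newPredicates Δ).Relations n)) fun i => FirstOrder.Language.Term.var i

/-- The sentence `∀ x_0 … x_{n-1}, (φ ↔ P_φ)`. -/
noncomputable def morleyAxiom {n : ℕ} (φ : L.Formula (Fin n))
    (hφ : (⟨n, φ⟩ : Σ n : ℕ, L.Formula (Fin n)) ∈ Δ) : (morleyLanguage Δ).Sentence :=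
  FirstOrder.Language.Formula.iAlls (Fin n)
    (FirstOrder.Language.Formula.relabel (Sum.inr : Fin n → Empty ⊕ Fin n)
      (((FirstOrder.Language.LHom.sumInl : L →ᴸ morleyLanguage Δ).onFormula φ).iff (morleyAtom φ hφ)))

/-- The theory `T⁺ = T ∪ {∀ x̄, (φ ↔ P_φ) : φ ∈ Δ}`. -/
def morleyTheory : (morleyLanguage Δ).Theory :=
  (FirstOrder.Language.LHom.sumInl : L →ᴸ morleyLanguage Δ).onTheory T ∪
    {ψ | ∃ (n : ℕ) (φ : L.Formula (Fin n)) (hφ : (⟨n, φ⟩ : Σ n : ℕ, L.Formula (Fin n)) ∈ Δ),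
      ψ = morleyAxiom Δ φ hφ}

/-- The set of atomic formulas `Δ⁺ = {P_φ(x̄) : φ ∈ Δ}`. -/
def morleyFormulas : FormulaSet (morleyLanguage Δ) :=
  {p | ∃ (n : ℕ) (φ : L.Formula (Fin n)) (hφ : (⟨n, φ⟩ : Σ n : ℕ, L.Formula (Fin n)) ∈ Δ),
    p = ⟨n, morleyAtom φ hφ⟩}

end Morley

/-- `(T₁, Δ₁) ⊴^rp_lam (T₂, Δ₂)` for arbitrary sets of formulas: the formulas are first made
atomic, that is, `(T₁⁺, Δ₁⁺) ⊴^rp_lam (T₂⁺, Δ₂⁺)`. -/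
def RPLE (lam : Cardinal.{t}) {L₁ : FirstOrder.Language.{u₁, v₁}} (T₁ : L₁.Theory) (Δ₁ : FormulaSet L₁)
    {L₂ : FirstOrder.Language.{u₂, v₂}} (T₂ : L₂.Theory) (Δ₂ : FormulaSet L₂) : Prop :=
  RPLEAtomic.{t, u₁, max u₁ v₁, w₁, u₂, max u₂ v₂, w₂} lam
    (morleyTheory T₁ Δ₁) (morleyFormulas Δ₁) (morleyTheory T₂ Δ₂) (morleyFormulas Δ₂)

/-- The pair `(T, Δ)` is `⊴^rp_lam`-maximal: every pair, in any language, is below it. -/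
def IsRPMaximalPair (lam : Cardinal.{t}) {L : FirstOrder.Language.{u, v}} (T : L.Theory)
    (Δ : FormulaSet L) : Prop :=
  ∀ (L₁ : FirstOrder.Language.{u₁, v₁}) (T₁ : L₁.Theory) (Δ₁ : FormulaSet L₁),
    RPLE.{t, u₁, v₁, w₁, u, v, w} lam T₁ Δ₁ T Δ

/-- For a set `Δ` of atomic formulas, the pair `(T, Δ)` is `⊴^rp_lam`-maximal among the pairs
`(T₁, Δ₁)` with `Δ₁` a set of atomic formulas. -/
def IsRPMaximalAtomicPair (lam : Cardinal.{t}) {L : FirstOrder.Language.{u, v}} (T : L.Theory)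
    (Δ : FormulaSet L) : Prop :=
  ∀ (L₁ : FirstOrder.Language.{u₁, v₁}) (T₁ : L₁.Theory) (Δ₁ : FormulaSet L₁), Δ₁ ⊆ atomicFormulas L₁ →
    RPLEAtomic.{t, u₁, v₁, w₁, u, v, w} lam T₁ Δ₁ T Δ

/-- The theory `T` is `⊴^rp_lam`-maximal: `T₁ ⊴^rp_lam T` for every theory `T₁`, where both theories
are taken with all their atomic formulas. -/
def IsRPMaximal (lam : Cardinal.{t}) {L : FirstOrder.Language.{u, v}} (T : L.Theory) : Prop :=
  ∀ (L₁ : FirstOrder.Language.{u₁, v₁}) (T₁ : L₁.Theory),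
    RPLEAtomic.{t, u₁, v₁, w₁, u, v, w} lam T₁ (atomicFormulas L₁) T (atomicFormulas L)

/-! ### The property SOP₃ -/

/-- `(T, φ(x̄, ȳ))` has SOP₃, where `x̄` and `ȳ` both have length `n`: the relation `φ` has an
infinite chain in some model of `T` and a directed 3-cycle in no model of `T`. -/
def HasSOP3 {L : FirstOrder.Language.{u, v}} (T : L.Theory) {n : ℕ} (φ : L.Formula (Fin (n + n))) : Prop :=
  (∃ (M : FirstOrder.Language.Theory.ModelType.{u, v, max u v} T) (a : ℕ → Fin n → M),
    ∀ i j, i < j → φ.Realize (Fin.append (a i) (a j))) ∧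
  ∀ (M : FirstOrder.Language.Theory.ModelType.{u, v, max u v} T) (a b c : Fin n → M),
    ¬ (φ.Realize (Fin.append a b) ∧ φ.Realize (Fin.append b c) ∧ φ.Realize (Fin.append c a))

/-- `φ` is equivalent, in the models of `T`, to a finite conjunction of atomic formulas. -/
def IsConjAtomic {L : FirstOrder.Language.{u, v}} (T : L.Theory) {k : ℕ} (φ : L.Formula (Fin k)) : Prop :=
  ∃ (r : ℕ) (ψ : Fin r → L.Formula (Fin k)), (∀ i, (ψ i).IsAtomic) ∧
    φ ⇔[T] (FirstOrder.Language.Formula.iInf ψ)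

end ReducedPowerOrder

namespace ReducedPowerOrder

open FirstOrder Filter Cardinal

/-! Everything passes through a property of the filter alone, `HasInterpolation`: cuts in reduced
products of finite linear orders are filled. Saturation for `φ` yields it
(`hasInterpolation_of_chain`): in each coordinate a long finite `φ`-chain codes an interval of ℕ,
and the absence of 3-cycles lets a number be read off from a realization of the coded cut, although
`φ` need not be transitive.

Conversely, for regular `D`, interpolation gives goodness (`HasInterpolation.exists_selector`) and
hence atomic saturation of every reduced power. The lexicographic order turns a common extension of
compatible finite sequences into an element of a cut. This serves a transfinite induction along a
well-order of the elements to be captured: at a lower set without maximum, the selectors for proper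
initial segments become successive entries of growing paths, arranged so that `b` lies in every
entry added after stage `b`. The last entry of an upper bound of these paths contains, modulo `D`,
every element. A maximum is absorbed by shrinking the families `K s`. -/

/-! ### Interpolation modulo a filter -/

/-- Given at most `lam` pairs of bounded functions `lo i, hi i : I → ℕ` such that each `lo i` is
below each `hi j` modulo `D`, some function lies modulo `D` between all the `lo i` and all the
`hi i`. -/
def HasInterpolation {I : Type t} (lam : Cardinal.{t}) (D : Filter I) : Prop :=
  ∀ A : Type t, #A ≤ lam → ∀ (N : I → ℕ) (lo hi : A → I → ℕ),
    (∀ i s, lo i s ≤ N s) → (∀ i s, hi i s ≤ N s) →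
    (∀ i j, ∀ᶠ s in D, lo i s ≤ hi j s) →
    ∃ c : I → ℕ, (∀ s, c s ≤ N s) ∧ ∀ i, ∀ᶠ s in D, lo i s ≤ c s ∧ c s ≤ hi i s

variable {I : Type t} {lam : Cardinal.{t}} {D : Filter I}

theorem HasInterpolation.exists_between (h : HasInterpolation lam D) {A : Type t} (hA : #A ≤ lam)
    (Y : I → Type w) [∀ s, Finite (Y s)] [∀ s, Nonempty (Y s)] [∀ s, LinearOrder (Y s)]
    (lo hi : A → ∀ s, Y s) (hle : ∀ i j, ∀ᶠ s in D, lo i s ≤ hi j s) :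
    ∃ c : ∀ s, Y s, ∀ i, ∀ᶠ s in D, lo i s ≤ c s ∧ c s ≤ hi i s := by
  classical
  have key : ∀ s, ∃ k : ℕ, Nonempty (Y s ≃o Fin (k + 1)) := fun s => by
    have := Fintype.ofFinite (Y s)
    obtain ⟨k, hk⟩ := Nat.exists_eq_succ_of_ne_zero (Fintype.card_ne_zero (α := Y s))
    exact ⟨k, ⟨(monoEquivOfFin (Y s) hk).symm⟩⟩
  choose k e using key
  have e := fun s => (e s).some
  obtain ⟨c, hcN, hc⟩ := h A hA k (fun i s => e s (lo i s)) (fun i s => e s (hi i s))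
    (fun i s => Nat.lt_succ_iff.1 (e s (lo i s)).2) (fun i s => Nat.lt_succ_iff.1 (e s (hi i s)).2)
    (fun i j => (hle i j).mono fun s hs => Fin.le_def.1 ((e s).monotone hs))
  refine ⟨fun s => (e s).symm ⟨c s, Nat.lt_succ_iff.2 (hcN s)⟩, fun i => (hc i).mono fun s hs => ?_⟩
  exact ⟨(e s).le_symm_apply.2 (Fin.le_def.2 hs.1), (e s).symm_apply_le.2 (Fin.le_def.2 hs.2)⟩

/-- The functions that agree with `z` below `l` form an interval of the lexicographic order. -/
theorem eq_of_lex_between {n k l : ℕ} (z w : Fin n → Fin (k + 1))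
    (h₁ : toLex (fun t : Fin n => if (t : ℕ) < l then z t else 0) ≤ toLex w)
    (h₂ : toLex w ≤ toLex (fun t : Fin n => if (t : ℕ) < l then z t else Fin.last k))
    (t : Fin n) (ht : (t : ℕ) < l) : w t = z t := by
  induction t using WellFoundedLT.induction with
  | ind t ih =>
    have hlt : ∀ r < t, w r = z r := fun r hr => ih r hr (lt_trans hr ht)
    -- A first disagreement at `t` would decide the lexicographic comparison, against `h₂` or `h₁`.
    refine le_antisymm (not_lt.1 fun hw => ?_) (not_lt.1 fun hw => ?_)
    · refine not_lt.2 h₂ ⟨t, fun r hr => ?_, ?_⟩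
      · simp [lt_trans (Fin.lt_def.1 hr) ht, hlt r hr]
      · simpa [ht] using hw
    · refine not_lt.2 h₁ ⟨t, fun r hr => ?_, ?_⟩
      · simp [lt_trans (Fin.lt_def.1 hr) ht, hlt r hr]
      · simpa [ht] using hw

/-- At most `lam` finite sequences, pairwise compatible modulo `D`, have a common extension. -/
theorem HasInterpolation.exists_extension (h : HasInterpolation lam D) {A : Type t} (hA : #A ≤ lam)
    (X : I → Type w) [∀ s, Finite (X s)] [∀ s, Nonempty (X s)] (n : I → ℕ)
    (l : A → I → ℕ) (c : A → ∀ s, ℕ → X s) (hl : ∀ i, ∀ᶠ s in D, l i s ≤ n s)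
    (hc : ∀ i j, ∀ᶠ s in D, ∀ r, r < l i s → r < l j s → c i s r = c j s r) :
    ∃ z : ∀ s, ℕ → X s, ∀ i, ∀ᶠ s in D, ∀ r < l i s, z s r = c i s r := by
  classical
  have key : ∀ s, ∃ k : ℕ, Nonempty (X s ≃ Fin (k + 1)) := fun s => by
    have := Fintype.ofFinite (X s)
    obtain ⟨k, hk⟩ := Nat.exists_eq_succ_of_ne_zero (Fintype.card_ne_zero (α := X s))
    exact ⟨k, ⟨Fintype.equivFinOfCardEq hk⟩⟩
  choose k e using key
  have e := fun s => (e s).some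
  -- Each sequence is padded to length `n s` by the least and by the greatest value; being between
  -- the two paddings means extending the sequence.
  obtain ⟨w, hw⟩ := h.exists_between hA (fun s => Lex (Fin (n s) → Fin (k s + 1)))
    (fun i s => toLex fun r => if (r : ℕ) < l i s then e s (c i s r) else 0)
    (fun i s => toLex fun r => if (r : ℕ) < l i s then e s (c i s r) else Fin.last _)
    (fun i j => (hc i j).mono fun s hs => Pi.toLex_monotone fun r => by
      split_ifs with h₁ h₂
      · rw [hs r h₁ h₂]
      · exact Fin.le_last _
      · exact Fin.zero_le _
      · exact Fin.zero_le _)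
  refine ⟨fun s r => if hr : r < n s then (e s).symm (ofLex (w s) ⟨r, hr⟩) else Classical.arbitrary _,
    fun i => ?_⟩
  filter_upwards [hw i, hl i] with s hs hls r hr
  have hrn := hr.trans_le hls
  have := eq_of_lex_between (fun r => e s (c i s r)) (ofLex (w s)) hs.1 hs.2 ⟨r, hrn⟩ hr
  simp only [hrn, dif_pos, this, Equiv.symm_apply_apply]

/-! ### Goodness -/

/-- A transfinite sequence along a lower set of a well-order, built so that all its terms are
related to the earlier ones. -/
theorem exists_coherent_family {J : Type*} [LinearOrder J] [WellFoundedLT J] {α : Type*} [Nonempty α]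
    (S : Set J) (hS : IsLowerSet S) (Q : α → Prop) (R : J → α → α → Prop)
    (ext : ∀ a ∈ S, ∀ c : J → α, (∀ b < a, Q (c b)) →
      (∀ b' < a, ∀ b < b', R b (c b) (c b')) → ∃ x, Q x ∧ ∀ b < a, R b (c b) x) :
    ∃ c : J → α, ∀ a ∈ S, Q (c a) ∧ ∀ b < a, R b (c b) (c a) := by
  classical
  -- The choice by `epsilon` makes the recursion total; that the chosen values are correct is proved
  -- afterwards by induction.
  let G : ∀ a : J, (∀ b, b < a → α) → α := fun a c =>
    Classical.epsilon fun x => Q x ∧ ∀ b (hb : b < a), R b (c b hb) x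
  let c : J → α := (wellFounded_lt (α := J)).fix G
  have hc : ∀ a, c a = G a fun b _ => c b := fun a => WellFounded.fix_eq _ _ _
  refine ⟨c, fun a => ?_⟩
  induction a using WellFoundedLT.induction with
  | ind a ih =>
    intro ha
    rw [hc a]
    exact Classical.epsilon_spec (ext a ha c (fun b hb => (ih b hb (hS hb.le ha)).1)
      fun b' hb' => (ih b' hb' (hS hb'.le ha)).2)

section Path

variable {J : Type t} {K : I → Set (Finset J)} {n : I → ℕ}

/-- A bounded path: for each `s` a length and a sequence of members of `K s`; modulo `D` the length
stays below the bound `n` by more than any constant. -/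
def IsPath (D : Filter I) (n : I → ℕ) (c : ∀ s, ℕ × (ℕ → K s)) : Prop :=
  ∀ k : ℕ, ∀ᶠ s in D, (c s).1 + k ≤ n s

/-- Modulo `D`, the path `c'` extends `c`, and `b` belongs to all the added members. -/
def PathLE (D : Filter I) (b : J) (c c' : ∀ s, ℕ × (ℕ → K s)) : Prop :=
  ∀ᶠ s in D, (c s).1 ≤ (c' s).1 ∧ (∀ r < (c s).1, (c' s).2 r = (c s).2 r) ∧
    ∀ r, (c s).1 ≤ r → r < (c' s).1 → b ∈ ((c' s).2 r : Finset J)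

/-- Interpolation is used twice: for a sequence `z` extending all the paths, and for the length at
which to cut it. -/
theorem HasInterpolation.exists_path_upper_bound [LinearOrder J] (h : HasInterpolation lam D)
    (hlam : ℵ₀ ≤ lam)
    (hJ : #J ≤ lam) (hKfin : ∀ s, (K s).Finite) (hK : ∀ s, (K s).Nonempty) (hn : Tendsto n D atTop)
    (S : Set J) (c : J → ∀ s, ℕ × (ℕ → K s)) (hQ : ∀ b ∈ S, IsPath D n (c b))
    (hR : ∀ b' ∈ S, ∀ b ∈ S, b < b' → PathLE D b (c b) (c b')) :
    ∃ x : ∀ s, ℕ × (ℕ → K s), IsPath D n x ∧ ∀ b ∈ S, PathLE D b (c b) x := by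
  classical
  have := fun s => (hKfin s).to_subtype
  have := fun s => (hK s).to_subtype
  have hSlam : #S ≤ lam := (mk_set_le S).trans hJ
  have hlen : ∀ b ∈ S, ∀ᶠ s in D, (c b s).1 ≤ n s := fun b hb => by simpa using hQ b hb 0
  obtain ⟨z, hz⟩ := h.exists_extension hSlam (fun s => K s) n (fun b s => (c b s).1)
    (fun b s => (c b s).2) (fun b => hlen b b.2) (fun b b' => by
      rcases lt_trichotomy b b' with hb | rfl | hb
      · exact (hR b' b'.2 b b.2 hb).mono fun s hs r hr _ => (hs.2.1 r hr).symm
      · exact Eventually.of_forall fun s r _ _ => rfl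
      · exact (hR b b.2 b' b'.2 hb).mono fun s hs r _ hr => hs.2.1 r hr)
  let P : S → I → ℕ → Prop := fun b s m => ∀ r, (c b s).1 ≤ r → r < m → (b : J) ∈ (z s r : Finset J)
  -- The cut must be beyond the length of every `c b`, before the first later entry of `z` that
  -- omits `b`, and below `n s - k` for every `k`, so that room remains for further steps.
  obtain ⟨ℓ, -, hℓ⟩ := h (S ⊕ ULift.{t} ℕ)
    (by
      rw [mk_sum, lift_id, lift_id]
      exact add_le_of_le hlam hSlam (by simpa using hlam))
    n (Sum.elim (fun b s => min (c b s).1 (n s)) fun _ _ => 0)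
    (Sum.elim (fun b s => Nat.findGreatest (P b s) (n s)) fun k s => n s - k.down)
    (by rintro (b | k) s <;> simp)
    (by rintro (b | k) s <;> simp [Nat.findGreatest_le])
    (by
      rintro (b | k) (b' | k')
      · refine Eventually.mono (p := fun s => P b' s (c b s).1) ?_ fun s hs => ?_
        · rcases lt_trichotomy b b' with hb | rfl | hb
          · exact (hR b' b'.2 b b.2 hb).mono fun s hs r h₁ h₂ => absurd (h₂.trans_le hs.1) (not_lt.2 h₁)
          · exact Eventually.of_forall fun s r h₁ h₂ => absurd h₂ (not_lt.2 h₁)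
          · filter_upwards [hR b b.2 b' b'.2 hb, hz b] with s hs hzs r h₁ h₂
            rw [hzs r h₂]
            exact hs.2.2 r h₁ h₂
        · exact Nat.le_findGreatest (min_le_right _ _) fun r h₁ h₂ =>
            hs r h₁ (h₂.trans_le (min_le_left _ _))
      · filter_upwards [hQ b b.2 k'.down] with s hs
        simp only [Sum.elim_inl, Sum.elim_inr]
        omega
      · simp
      · simp)
  refine ⟨fun s => (ℓ s, z s), fun k => ?_, fun b hb => ?_⟩
  · filter_upwards [hℓ (Sum.inr ⟨k⟩), hn.eventually_ge_atTop k] with s hs hk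
    have := hs.2
    simp only [Sum.elim_inr] at this
    omega
  · filter_upwards [hℓ (Sum.inl ⟨b, hb⟩), hlen b hb, hz ⟨b, hb⟩] with s hs hls hzs
    have h₁ := hs.1
    have h₂ := hs.2
    simp only [Sum.elim_inl, min_eq_left hls] at h₁ h₂
    -- `P` holds vacuously at 0, so the default value of `findGreatest` also satisfies it.
    have hP : P ⟨b, hb⟩ s (Nat.findGreatest (P ⟨b, hb⟩ s) (n s)) :=
      Nat.findGreatest_spec (Nat.zero_le _) fun r _ h => absurd h (Nat.not_lt_zero r)
    exact ⟨h₁, hzs, fun r hr hr' => hP r hr (hr'.trans_le h₂)⟩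

end Path

/-- `x` picks modulo `D` a member of each `K s` containing all elements of `S`. -/
def IsSelector {J : Type t} (D : Filter I) (K : I → Set (Finset J)) (S : Set J)
    (x : I → Finset J) : Prop :=
  (∀ s, x s ∈ K s) ∧ ∀ j ∈ S, ∀ᶠ s in D, j ∈ x s

/-- The induction step at a lower set without maximum. -/
theorem HasInterpolation.exists_selector_of_no_max {J : Type t} [LinearOrder J] [WellFoundedLT J]
    (h : HasInterpolation lam D) (hlam : ℵ₀ ≤ lam) (hJ : #J ≤ lam) {n : I → ℕ}
    (hn : Tendsto n D atTop) {K : I → Set (Finset J)} (hKfin : ∀ s, (K s).Finite)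
    (hK : ∀ s, (K s).Nonempty) (S : Set J) (hS : IsLowerSet S) (hmax : ∀ b ∈ S, ∃ b' ∈ S, b < b')
    (ih : ∀ a ∈ S, ∃ x, IsSelector D K (Set.Iio a) x) : ∃ x, IsSelector D K S x := by
  classical
  choose! x hx using ih
  have := fun s => (hK s).to_subtype
  -- Stage `a` appends the selector `x a` to an upper bound of the earlier paths; this uses up one
  -- unit of the spare room, hence `hy (k + 1)`.
  obtain ⟨c, hc⟩ := exists_coherent_family (α := ∀ s, ℕ × (ℕ → K s)) S hS (IsPath D n)
    (fun b c c' => PathLE D b c c' ∧ ∀ᶠ s in D, (c s).1 < (c' s).1) (by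
      intro a ha c hQ hR
      obtain ⟨y, hy, hy'⟩ := h.exists_path_upper_bound hlam hJ hKfin hK hn (Set.Iio a) c hQ
        fun b' hb' b _ hb => (hR b' hb' b hb).1
      refine ⟨fun s => ((y s).1 + 1, Function.update (y s).2 (y s).1 ⟨x a s, (hx a ha).1 s⟩),
        fun k => (hy (k + 1)).mono fun s hs => by dsimp only; omega, fun b hb => ⟨?_, ?_⟩⟩
      · filter_upwards [hy' b hb, (hx a ha).2 b hb] with s hs hxs
        refine ⟨hs.1.trans (Nat.le_succ _), fun r hr => ?_, fun r hr hr' => ?_⟩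
        · rw [Function.update_of_ne (hr.trans_le hs.1).ne, hs.2.1 r hr]
        · rcases (Nat.lt_succ_iff.1 hr').eq_or_lt with rfl | hlt
          · simpa using hxs
          · rw [Function.update_of_ne hlt.ne]
            exact hs.2.2 r hr hlt
      · exact (hy' b hb).mono fun s hs => Nat.lt_succ_of_le hs.1)
  obtain ⟨y, -, hy⟩ := h.exists_path_upper_bound hlam hJ hKfin hK hn S c (fun b hb => (hc b hb).1)
    fun b' hb' b _ hb => ((hc b' hb').2 b hb).1
  -- For `b < b'` in `S`, the path at `b'` is strictly longer than that at `b`, so the last entry of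
  -- `y` was added after stage `b`.
  refine ⟨fun s => (y s).2 ((y s).1 - 1), fun s => Subtype.prop _, fun b hb => ?_⟩
  obtain ⟨b', hb', hlt⟩ := hmax b hb
  filter_upwards [hy b hb, hy b' hb', ((hc b' hb').2 b hlt).2] with s h₁ h₂ h₃
  exact h₁.2.2 _ (by have := h₂.1; omega) (by have := h₂.1; omega)

/-- The induction hypothesis ranges over all families `K`, because the case of a maximum changes the
family. -/
theorem HasInterpolation.exists_selector_of_isLowerSet {J : Type t} [LinearOrder J] [WellFoundedLT J]
    (h : HasInterpolation lam D) (hlam : ℵ₀ ≤ lam) (hJ : #J ≤ lam) {n : I → ℕ}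
    (hn : Tendsto n D atTop) (S : Set J) (hS : IsLowerSet S)
    (ih : ∀ a ∈ S, ∀ K : I → Set (Finset J), (∀ s, (K s).Finite) → (∀ s, ∅ ∈ K s) →
      (∀ F, ∀ᶠ s in D, F ∈ K s) → ∃ x, IsSelector D K (Set.Iio a) x)
    (K : I → Set (Finset J)) (hKfin : ∀ s, (K s).Finite) (hK : ∀ s, ∅ ∈ K s)
    (hF : ∀ F, ∀ᶠ s in D, F ∈ K s) : ∃ x, IsSelector D K S x := by
  classical
  by_cases hmax : ∀ b ∈ S, ∃ b' ∈ S, b < b'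
  · exact h.exists_selector_of_no_max hlam hJ hn hKfin (fun s => ⟨∅, hK s⟩) S hS hmax
      fun a ha => ih a ha K hKfin hK hF
  · push Not at hmax
    obtain ⟨b, hb, hmax⟩ := hmax
    obtain ⟨x, hxK, hx⟩ := ih b hb (fun s => insert ∅ {F ∈ K s | insert b F ∈ K s})
      (fun s => ((hKfin s).subset (Set.sep_subset _ _)).insert _) (fun s => Set.mem_insert _ _)
      (fun F => by
        filter_upwards [hF F, hF (insert b F)] with s h₁ h₂
        exact Set.mem_insert_of_mem _ ⟨h₁, h₂⟩)
    have hxK' : ∀ᶠ s in D, insert b (x s) ∈ K s := by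
      filter_upwards [hF {b}] with s hs
      rcases hxK s with h₁ | h₁
      · rw [h₁]
        exact hs
      · exact h₁.2
    refine ⟨fun s => if insert b (x s) ∈ K s then insert b (x s) else ∅, fun s => ?_, fun j hj => ?_⟩
    · dsimp only
      split_ifs with h₁
      exacts [h₁, hK s]
    · rcases (hmax j hj).eq_or_lt with rfl | hlt
      · filter_upwards [hxK'] with s hs
        simp [hs]
      · filter_upwards [hxK', hx j hlt] with s hs hs'
        simp [hs, hs']

/-- A regular filter with interpolation is good: if `K s` is a finite family of finite sets which
contains modulo `D` every given finite set, then one can select members of the `K s` that contain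
modulo `D` every given element. -/
theorem HasInterpolation.exists_selector {J : Type t} (h : HasInterpolation lam D)
    (hlam : ℵ₀ ≤ lam) (hJ : #J ≤ lam) {n : I → ℕ} (hn : Tendsto n D atTop)
    (K : I → Set (Finset J)) (hKfin : ∀ s, (K s).Finite) (hK : ∀ s, ∅ ∈ K s)
    (hF : ∀ F, ∀ᶠ s in D, F ∈ K s) : ∃ x, IsSelector D K Set.univ x := by
  classical
  obtain ⟨_, _⟩ := exists_wellFoundedLT J
  refine h.exists_selector_of_isLowerSet hlam hJ hn _ isLowerSet_univ (fun a _ => ?_) K hKfin hK hF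
  clear * - h hlam hJ hn
  induction a using WellFoundedLT.induction with
  | ind a ih => exact h.exists_selector_of_isLowerSet hlam hJ hn _ (isLowerSet_Iio a) ih

/-! ### Atomic formulas in reduced powers -/

section Realize

variable {L : FirstOrder.Language.{u, v}} {M : Type w} [L.Structure M]

/-- The class of a function in the reduced power. -/
def ReducedPower.mk (D : Filter I) (x : I → M) : ReducedPower D M :=
  Quotient.mk (D.productSetoid fun _ : I => M) x

theorem ReducedPower.exists_rep (p : ReducedPower D M) : ∃ x : I → M, ReducedPower.mk D x = p :=
  Quotient.exists_rep p

theorem ReducedPower.realize_term {β : Type*} (x : β → I → M) (τ : L.Term β) :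
    (τ.realize fun i => ReducedPower.mk D (x i)) =
      ReducedPower.mk D fun s => τ.realize fun i => x i s := by
  induction τ with
  | var => rfl
  | func f ts ih =>
    simp only [FirstOrder.Language.Term.realize, ih]
    exact FirstOrder.Language.funMap_quotient_mk' (s := D.productSetoid fun _ : I => M) f
      fun i s => (ts i).realize fun j => x j s

/-- Łoś's theorem for atomic formulas, where no ultrafilter is needed. -/
theorem ReducedPower.realize_iff_of_isAtomic {β : Type*} {φ : L.Formula β} (hφ : φ.IsAtomic)
    (x : β → I → M) :
    (φ.Realize fun i => ReducedPower.mk D (x i)) ↔ ∀ᶠ s in D, φ.Realize fun i => x i s := by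
  have key : ∀ τ : L.Term (β ⊕ Fin 0),
      (τ.realize (Sum.elim (fun i => ReducedPower.mk D (x i)) default)) =
        ReducedPower.mk D fun s => τ.realize (Sum.elim (fun i => x i s) default) := fun τ => by
    rw [show (Sum.elim (fun i => ReducedPower.mk D (x i)) default :
        β ⊕ Fin 0 → ReducedPower D M) = fun i => ReducedPower.mk D (Sum.elim x default i) from
      funext (Sum.rec (fun _ => rfl) fun i => i.elim0), realize_term]
    congr! 3 with s
    exact funext (Sum.rec (fun _ => rfl) fun i => i.elim0)
  cases hφ with
  | equal τ₁ τ₂ =>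
    simp only [FirstOrder.Language.Formula.Realize, FirstOrder.Language.BoundedFormula.realize_bdEqual,
      key]
    exact Quotient.eq
  | rel R ts =>
    simp only [FirstOrder.Language.Formula.Realize, FirstOrder.Language.BoundedFormula.realize_rel, key]
    exact FirstOrder.Language.relMap_quotient_mk' (s := D.productSetoid fun _ : I => M) R
      fun i s => (ts i).realize (Sum.elim (fun i => x i s) default)

end Realize

/-! ### From goodness to saturation -/

theorem exists_finset_of_isRegularFilter (hreg : IsRegularFilter lam D) {J : Type t} (hJ : #J ≤ lam) :
    ∃ u : I → Finset J, ∀ j, ∀ᶠ s in D, j ∈ u s := by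
  obtain ⟨J₀, rfl, u, hu⟩ := hreg
  obtain ⟨f⟩ := hJ
  exact ⟨fun s => (u s).preimage f f.injective.injOn, fun j => by simpa using hu (f j)⟩

theorem exists_tendsto_of_isRegularFilter (hreg : IsRegularFilter lam D) (hlam : ℵ₀ ≤ lam) :
    ∃ n : I → ℕ, Tendsto n D atTop := by
  obtain ⟨u, hu⟩ := exists_finset_of_isRegularFilter hreg (J := ULift.{t} ℕ) (by simpa using hlam)
  refine ⟨fun s => (u s).card, tendsto_atTop.2 fun k => ?_⟩
  let F : Finset (ULift.{t} ℕ) := (Finset.range k).map Equiv.ulift.symm.toEmbedding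
  filter_upwards [(Finset.eventually_all F).2 fun j _ => hu j] with s hs
  calc k = F.card := by simp [F]
    _ ≤ _ := Finset.card_le_card hs

/-- The reduced power of any structure modulo a regular filter with interpolation is saturated for
atomic formulas. -/
theorem HasInterpolation.isSaturatedFor (h : HasInterpolation lam D) (hlam : ℵ₀ ≤ lam)
    (hreg : IsRegularFilter lam D) {L : FirstOrder.Language.{u, v}} {Δ : FormulaSet L}
    (hΔ : Δ ⊆ atomicFormulas L) (M : Type w) [L.Structure M] [Nonempty M] :
    IsSaturatedFor (Order.succ lam) Δ (ReducedPower D M) := by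
  classical
  intro m J hJ φ hφ σ hfin
  have hJ : #J ≤ lam := Order.lt_succ_iff.1 hJ
  choose rep hrep using ReducedPower.exists_rep (D := D) (M := M)
  let P : J → I → (Fin m → M) → Prop := fun j s x =>
    (φ j).2.Realize fun i => Sum.elim x (fun p => rep p s) (σ j i)
  have hP : ∀ (c : I → Fin m → M) (j : J),
      ((φ j).2.Realize fun i => Sum.elim (fun k => ReducedPower.mk D fun s => c s k) id (σ j i)) ↔
        ∀ᶠ s in D, P j s (c s) := fun c j => by
    have heq : (fun i => Sum.elim (fun k => ReducedPower.mk D fun s => c s k) id (σ j i)) =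
        fun i => ReducedPower.mk D fun s => Sum.elim (c s) (fun p => rep p s) (σ j i) := by
      funext i
      rcases σ j i with k | p
      · rfl
      · exact (hrep p).symm
    rw [heq, ReducedPower.realize_iff_of_isAtomic (hΔ (hφ j))]
  obtain ⟨n, hn⟩ := exists_tendsto_of_isRegularFilter hreg hlam
  obtain ⟨u, hu⟩ := exists_finset_of_isRegularFilter hreg hJ
  obtain ⟨x, hxK, hx⟩ := h.exists_selector hlam hJ hn
    -- These are the parts of the type satisfiable in coordinate `s`; regularity supplies the finite
    -- bound `u s`.
    (fun s => {F | F ⊆ u s ∧ ∃ y, ∀ j ∈ F, P j s y})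
    (fun s => (u s).powerset.finite_toSet.subset fun F hF => by simpa using hF.1)
    (fun s => ⟨Finset.empty_subset _, fun _ => Classical.arbitrary M, by simp⟩)
    (fun F => by
      obtain ⟨c, hc⟩ := hfin F
      have hc' : ∀ j ∈ F, ∀ᶠ s in D, P j s fun k => rep (c k) s := fun j hj => by
        rw [← hP]
        simpa only [hrep] using hc j hj
      filter_upwards [(Finset.eventually_all F).2 hc', (Finset.eventually_all F).2 fun j _ => hu j]
        with s h₁ h₂
      exact ⟨h₂, _, h₁⟩)
  choose _ y hy using hxK
  exact ⟨fun k => ReducedPower.mk D fun s => y s k, fun j => (hP y j).2 <|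
    (hx j trivial).mono fun s hs => hy s j hs⟩

/-! ### From saturation to interpolation -/

/-- Interpolation in terms of a binary relation with long finite chains and no directed 3-cycle. -/
theorem hasInterpolation_of_chain {X : Type w} (R : X → X → Prop)
    (hchain : ∀ N : ℕ, ∃ a : ℕ → X, ∀ j < N, ∀ i < j, R (a i) (a j))
    (hcycle : ∀ a b c, ¬ (R a b ∧ R b c ∧ R c a))
    (hsat : ∀ A : Type t, #A ≤ lam → ∀ lo hi : A → I → X,
      (∀ F : Finset A, ∃ c : I → X, ∀ i ∈ F, ∀ᶠ s in D, R (lo i s) (c s) ∧ R (c s) (hi i s)) →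
      ∃ c : I → X, ∀ i, ∀ᶠ s in D, R (lo i s) (c s) ∧ R (c s) (hi i s)) :
    HasInterpolation lam D := by
  classical
  intro A hA N lo hi hlo hhi hle
  choose a ha using fun s => hchain (3 * N s + 3)
  -- Each number gets three chain elements, so a strict gap with a point inside remains even when
  -- `lo` and `hi` coincide.
  obtain ⟨c, hc⟩ := hsat A hA (fun i s => a s (3 * lo i s)) (fun i s => a s (3 * hi i s + 2)) (by
    intro F
    refine ⟨fun s => a s (3 * F.sup (fun i => lo i s) + 1), fun i hi' => ?_⟩
    filter_upwards [(Finset.eventually_all F).2 fun j _ => hle j i] with s hs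
    have h₁ : lo i s ≤ F.sup fun i => lo i s := Finset.le_sup (f := fun i => lo i s) hi'
    have h₂ : (F.sup fun i => lo i s) ≤ hi i s := Finset.sup_le hs
    have h₃ := hhi i s
    exact ⟨ha s _ (by omega) _ (by omega), ha s _ (by omega) _ (by omega)⟩)
  refine ⟨fun s => Nat.findGreatest (fun k => R (a s (3 * k)) (c s)) (N s),
    fun s => Nat.findGreatest_le _, fun i => (hc i).mono fun s hs => ?_⟩
  refine ⟨Nat.le_findGreatest (hlo i s) hs.1, not_lt.1 fun hlt => ?_⟩
  beta_reduce at hlt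
  have hspec : R (a s (3 * Nat.findGreatest (fun k => R (a s (3 * k)) (c s)) (N s))) (c s) :=
    Nat.findGreatest_spec (P := fun k => R (a s (3 * k)) (c s)) (hlo i s) hs.1
  have hN := Nat.findGreatest_le (P := fun k => R (a s (3 * k)) (c s)) (N s)
  -- If `hi i s` were below the number read off from `c`, then `c`, the element coding `hi i s` and
  -- the later element related to `c` would form a 3-cycle.
  exact hcycle _ _ _ ⟨hs.2, ha s _ (by omega) _ (by omega), hspec⟩

section

variable {L : FirstOrder.Language.{u, v}} {M : Type w} [L.Structure M]

/-- Saturation of the reduced power, for a relation between tuples which is defined by a finite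
conjunction of atomic formulas of `Δ`. -/
theorem IsSaturatedFor.exists_between (hlam : ℵ₀ ≤ lam) {Δ : FormulaSet L}
    (hsat : IsSaturatedFor (Order.succ lam) Δ (ReducedPower D M)) {n r : ℕ}
    (ψ : Fin r → L.Formula (Fin (n + n))) (hψ : ∀ k, (ψ k).IsAtomic)
    (hψΔ : ∀ k, (⟨n + n, ψ k⟩ : Σ n : ℕ, L.Formula (Fin n)) ∈ Δ)
    (R : (Fin n → M) → (Fin n → M) → Prop) (hR : ∀ a b, R a b ↔ ∀ k, (ψ k).Realize (Fin.append a b))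
    (A : Type t) (hA : #A ≤ lam) (lo hi : A → I → Fin n → M)
    (hfin : ∀ F : Finset A, ∃ c : I → Fin n → M,
      ∀ i ∈ F, ∀ᶠ s in D, R (lo i s) (c s) ∧ R (c s) (hi i s)) :
    ∃ c : I → Fin n → M, ∀ i, ∀ᶠ s in D, R (lo i s) (c s) ∧ R (c s) (hi i s) := by
  classical
  -- The Boolean tells the lower condition (`true`) from the upper one; each conjunct is a separate
  -- member of the type.
  let σ : A × Fin r × Bool → Fin (n + n) → Fin n ⊕ ReducedPower D M := fun p =>
    bif p.2.2 then Fin.append (fun e => Sum.inr (ReducedPower.mk D fun s => lo p.1 s e)) Sum.inl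
    else Fin.append Sum.inl fun e => Sum.inr (ReducedPower.mk D fun s => hi p.1 s e)
  have hσ : ∀ (c : I → Fin n → M) (p : A × Fin r × Bool),
      ((ψ p.2.1).Realize fun e => Sum.elim (fun e => ReducedPower.mk D fun s => c s e) id (σ p e)) ↔
        ∀ᶠ s in D, (ψ p.2.1).Realize
          (bif p.2.2 then Fin.append (lo p.1 s) (c s) else Fin.append (c s) (hi p.1 s)) := by
    rintro c ⟨i, k, b⟩
    have heq : (fun e => Sum.elim (fun e => ReducedPower.mk D fun s => c s e) id (σ (i, k, b) e)) =
        fun e => ReducedPower.mk D fun s =>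
          (bif b then Fin.append (lo i s) (c s) else Fin.append (c s) (hi i s)) e := by
      funext e
      cases b <;> refine Fin.addCases (fun e => ?_) (fun e => ?_) e <;> simp [σ, -Fin.natAdd_eq_addNat]
    rw [heq, ReducedPower.realize_iff_of_isAtomic (hψ k)]
  obtain ⟨c, hc⟩ := hsat n (A × Fin r × Bool)
    (Order.lt_succ_iff.2 <| by
      rw [mk_prod, lift_uzero]
      exact mul_le_of_le hlam hA <| (lift_lt_aleph0.2 (mk_lt_aleph0)).le.trans hlam)
    (fun p => ⟨n + n, ψ p.2.1⟩) (fun p => hψΔ _) σ (fun F => by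
      obtain ⟨c, hc⟩ := hfin (F.image Prod.fst)
      refine ⟨fun e => ReducedPower.mk D fun s => c s e, fun p hp => (hσ c p).2 ?_⟩
      filter_upwards [hc p.1 (Finset.mem_image_of_mem _ hp)] with s hs
      rcases p with ⟨i, k, _ | _⟩
      · exact (hR _ _).1 hs.2 k
      · exact (hR _ _).1 hs.1 k)
  choose rep hrep using ReducedPower.exists_rep (D := D) (M := M)
  have hc' : ∀ p : A × Fin r × Bool, ∀ᶠ s in D, (ψ p.2.1).Realize
      (bif p.2.2 then Fin.append (lo p.1 s) (fun e => rep (c e) s)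
        else Fin.append (fun e => rep (c e) s) (hi p.1 s)) := fun p => by
    rw [← hσ (fun s e => rep (c e) s) p]
    simpa only [hrep] using hc p
  refine ⟨fun s e => rep (c e) s, fun i => ?_⟩
  filter_upwards [eventually_all.2 fun k => hc' (i, k, true),
    eventually_all.2 fun k => hc' (i, k, false)] with s h₁ h₂
  exact ⟨(hR _ _).2 h₁, (hR _ _).2 h₂⟩

end

/-! ### The property SOP₃ in models of a complete theory -/

section SOP3

variable {L : FirstOrder.Language.{u, v}} {T : L.Theory} {n : ℕ} {φ : L.Formula (Fin (n + n))}

theorem uncurry_comp_append {κ : Type*} {M : Type*} {n : ℕ} (a : κ → Fin n → M) (i j : κ) :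
    (fun p : κ × Fin n => a p.1 p.2) ∘ Fin.append (fun e => (i, e)) (fun e => (j, e)) =
      Fin.append (a i) (a j) := by
  funext e
  refine Fin.addCases (fun e => ?_) (fun e => ?_) e <;> simp [-Fin.natAdd_eq_addNat]

/-- A chain of given finite length is expressed by a sentence, which completeness carries to every
model. -/
theorem HasSOP3.exists_chain (hφ : HasSOP3 T φ) (hT : T.IsComplete) (M : Type w) [L.Structure M]
    [Nonempty M] [M ⊨ T] (N : ℕ) :
    ∃ a : ℕ → Fin n → M, ∀ j < N, ∀ i < j, φ.Realize (Fin.append (a i) (a j)) := by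
  let χ : L.Sentence := FirstOrder.Language.Formula.iExs (Fin N × Fin n)
    (FirstOrder.Language.Formula.iInf fun p : {p : Fin N × Fin N // p.1 < p.2} =>
      FirstOrder.Language.Formula.relabel
        (fun e => (Sum.inr (Fin.append (fun e => (p.1.1, e)) (fun e => (p.1.2, e)) e) :
          Empty ⊕ (Fin N × Fin n))) φ)
  obtain ⟨M₀, a, ha⟩ := hφ.1
  have h₀ : M₀ ⊨ χ := by
    simp only [χ, FirstOrder.Language.Sentence.Realize, FirstOrder.Language.Formula.realize_iExs,
      FirstOrder.Language.Formula.realize_iInf, FirstOrder.Language.Formula.realize_relabel]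
    refine ⟨fun p => a p.1 p.2, fun p => ?_⟩
    convert ha p.1.1 p.1.2 p.2 using 1
    funext e
    refine Fin.addCases (fun e => ?_) (fun e => ?_) e <;> simp [-Fin.natAdd_eq_addNat]
  have h₁ : M ⊨ χ := (hT.realize_sentence_iff χ M).2 ((hT.realize_sentence_iff χ M₀).1 h₀)
  simp only [χ, FirstOrder.Language.Sentence.Realize, FirstOrder.Language.Formula.realize_iExs,
      FirstOrder.Language.Formula.realize_iInf, FirstOrder.Language.Formula.realize_relabel] at h₁
  obtain ⟨b, hb⟩ := h₁
  refine ⟨fun i e => if hi : i < N then b (⟨i, hi⟩, e) else Classical.arbitrary M,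
    fun j hj i hij => ?_⟩
  convert hb ⟨(⟨i, hij.trans hj⟩, ⟨j, hj⟩), hij⟩ using 1
  funext e
  refine Fin.addCases (fun e => ?_) (fun e => ?_) e <;> simp [hj, hij.trans hj, -Fin.natAdd_eq_addNat]

/-- Having no 3-cycle is a consequence of `T`, so it passes to models in any universe. -/
theorem HasSOP3.not_cycle (hφ : HasSOP3 T φ) (M : Type w) [L.Structure M]
    [Nonempty M] [M ⊨ T] (a b c : Fin n → M) :
    ¬ (φ.Realize (Fin.append a b) ∧ φ.Realize (Fin.append b c) ∧ φ.Realize (Fin.append c a)) := by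
  let g : Fin 3 → Fin 3 → Fin (n + n) → Fin 3 × Fin n := fun i j =>
    Fin.append (fun e => (i, e)) (fun e => (j, e))
  let χ : L.Formula (Fin 3 × Fin n) :=
    (φ.relabel (g 0 1) ⊓ (φ.relabel (g 1 2) ⊓ φ.relabel (g 2 0))).not
  have hχ : T ⊨ᵇ χ := FirstOrder.Language.Theory.models_formula_iff.2 fun M₀ x => by
    have := hφ.2 M₀ (fun e => x (0, e)) (fun e => x (1, e)) (fun e => x (2, e))
    rw [FirstOrder.Language.Formula.realize_not]
    simp only [FirstOrder.Language.Formula.realize_inf, FirstOrder.Language.Formula.realize_relabel]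
    have hx := uncurry_comp_append (fun i e => x (i, e))
    simp only [Prod.mk.eta] at hx
    rw [hx, hx, hx]
    exact this
  have := hχ.realize_formula M (v := fun p : Fin 3 × Fin n => (![a, b, c] : Fin 3 → Fin n → M) p.1 p.2)
  rw [FirstOrder.Language.Formula.realize_not] at this
  simp only [FirstOrder.Language.Formula.realize_inf, FirstOrder.Language.Formula.realize_relabel] at this
  simp only [g, uncurry_comp_append] at this
  exact this

end SOP3

/-- If `φ` with SOP₃ is interpreted in `M` by a finite conjunction of atomic formulas, in a possibly
larger language, and the reduced power of `M` is saturated for these, then `D` has interpolation. -/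
theorem HasSOP3.hasInterpolation {L : FirstOrder.Language.{u, v}} {T : L.Theory} {n : ℕ}
    {φ : L.Formula (Fin (n + n))} (hφ : HasSOP3 T φ) (hT : T.IsComplete) (hlam : ℵ₀ ≤ lam)
    (M : Type w) [L.Structure M] [Nonempty M] [M ⊨ T]
    {L' : FirstOrder.Language.{u₂, v₂}} [L'.Structure M] {Δ : FormulaSet L'}
    (hsat : IsSaturatedFor (Order.succ lam) Δ (ReducedPower D M)) {r : ℕ}
    (ψ : Fin r → L'.Formula (Fin (n + n))) (hψ : ∀ k, (ψ k).IsAtomic)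
    (hψΔ : ∀ k, (⟨n + n, ψ k⟩ : Σ n : ℕ, L'.Formula (Fin n)) ∈ Δ)
    (hφψ : ∀ x : Fin (n + n) → M, φ.Realize x ↔ ∀ k, (ψ k).Realize x) :
    HasInterpolation lam D :=
  hasInterpolation_of_chain (fun a b : Fin n → M => φ.Realize (Fin.append a b))
    (hφ.exists_chain hT M) (hφ.not_cycle M)
    (hsat.exists_between hlam ψ hψ hψΔ _ fun _ _ => hφψ _)

/-! ### The new predicates -/

section Morley

variable {L : FirstOrder.Language.{u, v}} {T : L.Theory} {Δ : FormulaSet L}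

theorem isAtomic_morleyAtom {n : ℕ} (φ : L.Formula (Fin n))
    (hφ : (⟨n, φ⟩ : Σ n : ℕ, L.Formula (Fin n)) ∈ Δ) : (morleyAtom φ hφ).IsAtomic :=
  .rel _ _

theorem morleyFormulas_subset : morleyFormulas Δ ⊆ atomicFormulas (morleyLanguage Δ) := by
  rintro _ ⟨n, φ, hφ, rfl⟩
  exact isAtomic_morleyAtom φ hφ

theorem realize_morleyAtom_iff (M : Type w) [L.Structure M] [(morleyLanguage Δ).Structure M]
    [(FirstOrder.Language.LHom.sumInl : L →ᴸ morleyLanguage Δ).IsExpansionOn M]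
    [M ⊨ morleyTheory T Δ] {n : ℕ} (φ : L.Formula (Fin n))
    (hφ : (⟨n, φ⟩ : Σ n : ℕ, L.Formula (Fin n)) ∈ Δ) (x : Fin n → M) :
    φ.Realize x ↔ (morleyAtom φ hφ).Realize x := by
  have h : M ⊨ morleyAxiom Δ φ hφ :=
    FirstOrder.Language.Theory.realize_sentence_of_mem (morleyTheory T Δ) (Or.inr ⟨n, φ, hφ, rfl⟩)
  simp only [morleyAxiom, FirstOrder.Language.Sentence.Realize,
    FirstOrder.Language.Formula.realize_iAlls, FirstOrder.Language.Formula.realize_relabel,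
    FirstOrder.Language.Formula.realize_iff, FirstOrder.Language.LHom.realize_onFormula] at h
  exact h x

end Morley

/-! ### Maximality -/

section Maximal

variable {L : FirstOrder.Language.{u, v}} {T : L.Theory} {n : ℕ} {φ : L.Formula (Fin (n + n))}

theorem HasSOP3.isRPMaximalPair (hφ : HasSOP3 T φ) (hT : T.IsComplete) (hlam : ℵ₀ ≤ lam)
    (Δ : FormulaSet L) (hΔ : ⟨n + n, φ⟩ ∈ Δ) :
    IsRPMaximalPair.{t, u, v, w, u₁, v₁, w₁} lam T Δ := by
  intro L₁ T₁ Δ₁ I D _ _ hreg M₁ _ _ _ M₂ _ _ hM₂ hsat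
  -- SOP₃ is read in the reduct to `L`, saturation in the expansion, where `φ` is the single atom
  -- `P_φ`.
  let _ : L.Structure M₂ :=
    (FirstOrder.Language.LHom.sumInl : L →ᴸ morleyLanguage Δ).reduct M₂
  have : M₂ ⊨ T := by
    rw [← FirstOrder.Language.LHom.onTheory_model
      (FirstOrder.Language.LHom.sumInl : L →ᴸ morleyLanguage Δ)]
    exact hM₂.mono Set.subset_union_left
  refine HasInterpolation.isSaturatedFor ?_ hlam hreg morleyFormulas_subset M₁
  exact hφ.hasInterpolation hT hlam M₂ hsat (fun _ : Fin 1 => morleyAtom φ hΔ)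
    (fun _ => isAtomic_morleyAtom φ hΔ) (fun _ => ⟨_, φ, hΔ, rfl⟩)
    fun x => by simpa using realize_morleyAtom_iff (T := T) M₂ φ hΔ x

theorem HasSOP3.isRPMaximalAtomicPair (hφ : HasSOP3 T φ) (hT : T.IsComplete) (hlam : ℵ₀ ≤ lam)
    (hat : φ.IsAtomic) :
    IsRPMaximalAtomicPair.{t, u, v, w, u₁, v₁, w₁} lam T {⟨n + n, φ⟩} := by
  intro L₁ T₁ Δ₁ hΔ₁ I D _ _ hreg M₁ _ _ _ M₂ _ _ _ hsat
  exact (hφ.hasInterpolation hT hlam M₂ hsat (fun _ : Fin 1 => φ) (fun _ => hat) (fun _ => rfl)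
    fun x => by simp).isSaturatedFor hlam hreg hΔ₁ M₁

theorem HasSOP3.isRPMaximal (hφ : HasSOP3 T φ) (hT : T.IsComplete) (hlam : ℵ₀ ≤ lam)
    (hconj : IsConjAtomic T φ) : IsRPMaximal.{t, u, v, w, u₁, v₁, w₁} lam T := by
  obtain ⟨r, ψ, hψ, hiff⟩ := hconj
  intro L₁ T₁ I D _ _ hreg M₁ _ _ _ M₂ _ _ _ hsat
  exact (hφ.hasInterpolation hT hlam M₂ hsat ψ hψ hψ fun x =>
    hiff.realize_iff.trans FirstOrder.Language.Formula.realize_iInf).isSaturatedFor hlam hreg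
      subset_rfl M₁

end Maximal

end ReducedPowerOrder

theorem mainTheorem5 {L : FirstOrder.Language.{u, v}} (T : L.Theory) (hT : T.IsComplete)
    {n : ℕ} (φ : L.Formula (Fin (n + n))) (hφ : ReducedPowerOrder.HasSOP3 T φ)
    (lam : Cardinal.{t}) (hlam : Cardinal.aleph0 ≤ lam) :
    -- the pair `(T, {φ})` is maximal, for an arbitrary first order formula `φ`
    ReducedPowerOrder.IsRPMaximalPair.{t, u, v, w, u₁, v₁, w₁} lam T {⟨n + n, φ⟩} ∧
    -- so is every pair `(T, Δ)` with `φ ∈ Δ`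
    (∀ Δ : ReducedPowerOrder.FormulaSet L, ⟨n + n, φ⟩ ∈ Δ →
      ReducedPowerOrder.IsRPMaximalPair.{t, u, v, w, u₁, v₁, w₁} lam T Δ) ∧
    -- for atomic `φ`, maximality of `(T, {φ})` in terms of the reduced powers themselves
    (φ.IsAtomic →
      ReducedPowerOrder.IsRPMaximalAtomicPair.{t, u, v, w, u₁, v₁, w₁} lam T {⟨n + n, φ⟩}) ∧
    -- the theory `T` is maximal if `φ` is atomic, or equivalent to a conjunction of atomic formulas
    (ReducedPowerOrder.IsConjAtomic T φ →
      ReducedPowerOrder.IsRPMaximal.{t, u, v, w, u₁, v₁, w₁} lam T) := by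
  exact ⟨hφ.isRPMaximalPair hT hlam _ rfl, hφ.isRPMaximalPair hT hlam,
    hφ.isRPMaximalAtomicPair hT hlam, hφ.isRPMaximal hT hlam⟩
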